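/- For a real number $x$ let $\{x\}=x-\lfloor x\rfloor$ denote its fractional part. Positive integers $v_1<v_2<\dots<v_n$ form an instance of the lonely runner problem. The instance is a counterexample if there is no real $t$ with $\frac1{n+1}\le\{v_it\}\le\frac n{n+1}$ for all $i=1,\dots,n$. It is tight if such a $t$ exists, but there is no real $t$ with $\frac1{n+1}<\{v_it\}<\frac n{n+1}$ for all $i=1,\dots,n$. It is loose if it is neither a counterexample nor tight; equivalently, if there is a real $t$ with $\frac1{n+1}<\{v_it\}<\frac n{n+1}$ for all $i=1,\dots,n$. **Theorem.** There exist a real constant $C$ and a positive integer $N$ such that for every integer $n\ge N$ the following holds: if $v_1<v_2<\dots<v_n$ are positive integers with $$n<v_n\le 2n-\exp\bigl(C(\log\log n)^2\bigr),$$ then the instance $v_1<v_2<\dots<v_n$ is loose, that is, there is a real number $t$ such that $$\frac1{n+1}<\{v_it\}<\frac n{n+1}\qquad\text{for all } i=1,\dots,n.$$ -/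

import Mathlib

/-- The set of times at which every runner of the instance `v` has position (fractional part of
`v i * t`) in the closed arc `[1/(n+1), n/(n+1)]`. -/
def LonelyRunner.weakTimes {n : ℕ} (v : Fin n → ℕ) : Set ℝ :=
  {t : ℝ | ∀ i : Fin n, (1 : ℝ) / (n + 1) ≤ Int.fract ((v i : ℝ) * t) ∧
    Int.fract ((v i : ℝ) * t) ≤ (n : ℝ) / (n + 1)}

/-- The set of times at which every runner of the instance `v` has position in the open arc
`(1/(n+1), n/(n+1))`. -/
def LonelyRunner.strictTimes {n : ℕ} (v : Fin n → ℕ) : Set ℝ :=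
  {t : ℝ | ∀ i : Fin n, (1 : ℝ) / (n + 1) < Int.fract ((v i : ℝ) * t) ∧
    Int.fract ((v i : ℝ) * t) < (n : ℝ) / (n + 1)}

/-- `v` is a counterexample to the lonely runner conjecture: no suitable time exists. -/
def LonelyRunner.IsCounterexample {n : ℕ} (v : Fin n → ℕ) : Prop :=
  ¬ ∃ t : ℝ, t ∈ LonelyRunner.weakTimes v

/-- `v` is tight: a suitable time exists, but none with strict inequalities. -/
def LonelyRunner.IsTight {n : ℕ} (v : Fin n → ℕ) : Prop :=
  (∃ t : ℝ, t ∈ LonelyRunner.weakTimes v) ∧ ¬ ∃ t : ℝ, t ∈ LonelyRunner.strictTimes v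

/-- `v` is loose: neither a counterexample nor tight. -/
def LonelyRunner.IsLoose {n : ℕ} (v : Fin n → ℕ) : Prop :=
  ¬ LonelyRunner.IsCounterexample v ∧ ¬ LonelyRunner.IsTight v

/-- An instance is loose iff some real time satisfies all the inequalities strictly. -/
theorem LonelyRunner.isLoose_iff {n : ℕ} (v : Fin n → ℕ) :
    LonelyRunner.IsLoose v ↔
      ∃ t : ℝ, ∀ i : Fin n, (1 : ℝ) / (n + 1) < Int.fract ((v i : ℝ) * t) ∧
        Int.fract ((v i : ℝ) * t) < (n : ℝ) / (n + 1) := by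
  constructor
  · rintro ⟨h1, h2⟩
    by_contra h
    exact h2 ⟨not_not.mp h1, h⟩
  · rintro ⟨t, ht⟩
    exact ⟨fun h => h ⟨t, fun i => ⟨(ht i).1.le, (ht i).2.le⟩⟩, fun h => h.2 ⟨t, ht⟩⟩

/-! Let `w` be the largest speed and `X` the set of missing speeds in `[1, w]`, so that `X` has `w -
n` elements. If no strict time exists, three constructions of times restrict `X`. The time `1/x`
excludes missing `x` with `w/2 < x ≤ n`. A small shift of a fraction with denominator `x` excludes
missing `x` below about `w/2 - (w - n)`. A fraction with denominator `x + y` excludes coprime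
missing `x`, `y` with `w < x + y ≤ 2n + 1`.

Pair blocks of length `2m` going down from `w/2` with blocks going up from `n`: sums across a pair
lie in the last range, so no missing speeds across it are coprime. If such a pair holds at most `2m`
elements of `X`, half its size, then `X` has at most `w - 1 - n` elements, because `w` is not
missing. This is a contradiction.

The half bound is arithmetic (`IsSieveLength.card_add_card_le`). By parity it reduces to two
progressions of difference 2 and opposite parity, where the prime 2 plays no role. If `S` is at most
about half of one progression, some `s` in `S` is coprime to at least `|S|` terms of the other.
Otherwise Brun's sieve makes `∏ p/(p-1)` over odd primes `p ∣ s` at least about `m/|S|` throughout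
`S`, so its square has mean at least about `m/|S|`, nearly 2, over the progression; but that mean is
at most about 1.87. Brun's sieve needs only `m` of size `exp(O((log log n)^2))`. -/

/-! ### Brun's sieve in progressions of difference 2. -/

theorem mul_dvd_iff_of_coprime {q D x : ℕ} (h : Nat.Coprime q D) :
    q * D ∣ x ↔ q ∣ x ∧ D ∣ x :=
  ⟨fun hx => ⟨dvd_of_mul_right_dvd hx, dvd_of_mul_left_dvd hx⟩,
    fun hx => Nat.Coprime.mul_dvd_of_dvd_of_dvd h hx.1 hx.2⟩

/-- In a progression of difference `2`, the multiples of an odd `D` have density `1/D` up to an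
error of at most one element. -/
theorem abs_card_dvd_sub_le (a m D : ℕ) (hD : Odd D) :
    |(((Finset.range m).filter fun i => D ∣ a + 2 * i).card : ℝ) - m / D| ≤ 1 := by
  obtain ⟨e, rfl⟩ := hD
  have hpos : 0 < 2 * e + 1 := by omega
  -- The root is `a * e`, since `2 * e ≡ -1` modulo `2 * e + 1`.
  have hiff : ∀ i, (2 * e + 1 ∣ a + 2 * i) ↔ i ≡ a * e [MOD 2 * e + 1] := by
    intro i
    have hc : Nat.Coprime (2 * e + 1) 2 := by simp
    have h0 : a + 2 * (a * e) ≡ 0 [MOD 2 * e + 1] := by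
      rw [Nat.modEq_zero_iff_dvd]; exact ⟨a, by ring⟩
    rw [← Nat.modEq_zero_iff_dvd]
    constructor
    · intro h
      exact Nat.ModEq.cancel_left_of_coprime hc (Nat.ModEq.add_left_cancel' a (h.trans h0.symm))
    · intro h
      exact ((h.mul_left 2).add_left a).trans h0
  have hcard : ((Finset.range m).filter fun i => 2 * e + 1 ∣ a + 2 * i).card
      = m / (2 * e + 1) + if (a * e) % (2 * e + 1) < m % (2 * e + 1) then 1 else 0 := by
    rw [← Nat.count_modEq_card m hpos (a * e), Nat.count_eq_card_filter_range]
    simp only [hiff]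
  rw [hcard]
  have h1 : ((m / (2 * e + 1) : ℕ) : ℝ) ≤ (m : ℝ) / (2 * e + 1 : ℕ) := Nat.cast_div_le
  have h2 : (m : ℝ) / (2 * e + 1 : ℕ) < ((m / (2 * e + 1) : ℕ) : ℝ) + 1 := by
    rw [div_lt_iff₀ (by positivity)]
    exact_mod_cast Nat.lt_mul_of_div_lt (Nat.lt_succ_self (m / (2 * e + 1))) hpos
  split_ifs <;> rw [abs_le] <;> push_cast at * <;> constructor <;> linarith

/-- A finite set of integers `≥ 2` satisfies `∏ (1 - 1/p) ≥ 1/(#Q + 1)`. -/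
theorem inv_card_add_one_le_prod (Q : Finset ℕ) (hQ : ∀ p ∈ Q, 2 ≤ p) :
    1 / ((Q.card : ℝ) + 1) ≤ ∏ p ∈ Q, (1 - 1 / (p : ℝ)) := by
  induction Q using Finset.induction_on_max with
  | empty => simp
  | insert q Q hq ih =>
    have hnot : q ∉ Q := fun h => lt_irrefl _ (hq q h)
    rw [Finset.prod_insert hnot, Finset.card_insert_of_notMem hnot]
    have ih' := ih fun p hp => hQ p (Finset.mem_insert_of_mem hp)
    -- The largest element of a set of `Q.card + 1` integers `≥ 2` is at least `Q.card + 2`; the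
    -- resulting product telescopes.
    have hcard : Q.card + 2 ≤ q := by
      have h2 : 2 ≤ q := hQ q (Finset.mem_insert_self _ _)
      have hs : Q ⊆ Finset.Ico 2 q := fun p hp =>
        Finset.mem_Ico.2 ⟨hQ p (Finset.mem_insert_of_mem hp), hq p hp⟩
      have := Finset.card_le_card hs
      rw [Nat.card_Ico] at this
      omega
    have hc : (Q.card : ℝ) + 2 ≤ q := by exact_mod_cast hcard
    have h0 : (0 : ℝ) ≤ Q.card := by positivity
    have h3 : 1 - 1 / ((Q.card : ℝ) + 2) ≤ 1 - 1 / (q : ℝ) := by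
      have := one_div_le_one_div_of_le (by positivity : (0 : ℝ) < Q.card + 2) hc
      linarith
    calc 1 / (((Q.card + 1 : ℕ) : ℝ) + 1)
        = (1 - 1 / ((Q.card : ℝ) + 2)) * (1 / ((Q.card : ℝ) + 1)) := by
          push_cast; field_simp; ring
      _ ≤ (1 - 1 / (q : ℝ)) * ∏ p ∈ Q, (1 - 1 / (p : ℝ)) := by
          refine mul_le_mul h3 ih' (by positivity) ?_
          refine le_trans ?_ h3
          rw [sub_nonneg, div_le_one (by positivity)]; linarith

/-- Brun's sieve in a progression of difference `2`, for a set `Q` of odd primes. -/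
theorem abs_sieve_sub_le (a m L : ℕ) (hL : 1 ≤ L) (Q : Finset ℕ) :
    (∀ p ∈ Q, p.Prime ∧ Odd p) → ∀ k D : ℕ, Odd D → (∀ p ∈ Q, Nat.Coprime p D) →
    |(((Finset.range m).filter fun i => D ∣ a + 2 * i ∧ ∀ p ∈ Q, ¬ p ∣ a + 2 * i).card : ℝ)
        - (m : ℝ) / D * ∏ p ∈ Q, (1 - 1 / (p : ℝ))|
      ≤ (m : ℝ) / D * (1 / 2 ^ k) * ∏ p ∈ Q, (1 + 2 / (p : ℝ)) + (L : ℝ) ^ k * (1 + 1 / (L : ℝ)) ^ Q.card := by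
  have hL' : (1 : ℝ) ≤ L := by exact_mod_cast hL
  induction Q using Finset.induction_on with
  | empty =>
    intro _ k D hD _
    have h := abs_card_dvd_sub_le a m D hD
    have h1 : (1 : ℝ) ≤ L ^ k := one_le_pow₀ hL'
    have h2 : (0 : ℝ) ≤ (m : ℝ) / D * (1 / 2 ^ k) := by positivity
    simp only [Finset.notMem_empty, false_imp_iff, implies_true, and_true, Finset.prod_empty,
      mul_one, Finset.card_empty, pow_zero]
    linarith
  | insert q Q hq ih =>
    intro hQ k D hD hcop
    have hQ' : ∀ p ∈ Q, p.Prime ∧ Odd p := fun p hp => hQ p (Finset.mem_insert_of_mem hp)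
    have hqp := hQ q (Finset.mem_insert_self _ _)
    have hcop' : ∀ p ∈ Q, Nat.Coprime p D := fun p hp => hcop p (Finset.mem_insert_of_mem hp)
    have hprod1 : ∏ p ∈ insert q Q, (1 - 1 / (p : ℝ)) ≤ 1 := by
      refine Finset.prod_le_one (fun p hp => ?_) (fun p hp => ?_)
      · have : (1 : ℝ) ≤ p := by exact_mod_cast (hQ p hp).1.one_le
        rw [sub_nonneg, div_le_one (by linarith)]; exact this
      · simp
    have hprod0 : 0 ≤ ∏ p ∈ insert q Q, (1 - 1 / (p : ℝ)) := by
      refine Finset.prod_nonneg fun p hp => ?_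
      have : (1 : ℝ) ≤ p := by exact_mod_cast (hQ p hp).1.one_le
      rw [sub_nonneg, div_le_one (by linarith)]; exact this
    -- `k` is the truncation depth. Sifting by `q` subtracts the count for `q * D`, which is
    -- estimated at depth `k - 1`; at depth 0 the count is only bounded between 0 and the unsifted
    -- count. The factor `2 ^ (-k) ∏ (1 + 2/p)` is Rankin's bound for the truncated terms.
    cases k with
    | zero =>
      have h := abs_le.1 (abs_card_dvd_sub_le a m D hD)
      have hle : (((Finset.range m).filter fun i =>
          D ∣ a + 2 * i ∧ ∀ p ∈ insert q Q, ¬ p ∣ a + 2 * i).card : ℝ)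
          ≤ ((Finset.range m).filter fun i => D ∣ a + 2 * i).card := by
        refine Nat.cast_le.2 (Finset.card_le_card fun i hi => ?_)
        rw [Finset.mem_filter] at hi ⊢
        exact ⟨hi.1, hi.2.1⟩
      have hP : (1 : ℝ) ≤ ∏ p ∈ insert q Q, (1 + 2 / (p : ℝ)) :=
        Finset.one_le_prod fun p _ => by
          have : (0 : ℝ) ≤ 2 / p := by positivity
          linarith
      have hR : (1 : ℝ) ≤ (1 + 1 / (L : ℝ)) ^ (insert q Q).card :=
        one_le_pow₀ (by have : (0 : ℝ) ≤ 1 / L := by positivity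
                        linarith)
      have hmD : (0 : ℝ) ≤ m / D := by positivity
      have e1 := mul_le_mul_of_nonneg_left hprod1 hmD
      have e2 := mul_nonneg hmD hprod0
      have e3 := mul_le_mul_of_nonneg_left hP hmD
      have e4 : (0 : ℝ) ≤ (((Finset.range m).filter fun i =>
          D ∣ a + 2 * i ∧ ∀ p ∈ insert q Q, ¬ p ∣ a + 2 * i).card : ℝ) := by positivity
      simp only [pow_zero, div_one, mul_one, one_mul] at *
      rw [abs_le]; constructor <;> linarith [h.1, h.2]
    | succ k =>
      have hqD : Nat.Coprime q D := hcop q (Finset.mem_insert_self _ _)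
      have i1 := ih hQ' (k + 1) D hD hcop'
      have i2 := ih hQ' k (q * D) (hqp.2.mul hD) fun p hp =>
        Nat.Coprime.mul_right ((Nat.coprime_primes (hQ' p hp).1 hqp.1).2
          fun h => hq (h ▸ hp)) (hcop' p hp)
      have hsplit : ((Finset.range m).filter fun i => D ∣ a + 2 * i ∧ ∀ p ∈ Q, ¬ p ∣ a + 2 * i).card
          = ((Finset.range m).filter fun i =>
              q * D ∣ a + 2 * i ∧ ∀ p ∈ Q, ¬ p ∣ a + 2 * i).card
            + ((Finset.range m).filter fun i =>
              D ∣ a + 2 * i ∧ ∀ p ∈ insert q Q, ¬ p ∣ a + 2 * i).card := by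
        rw [← Finset.card_filter_add_card_filter_not (fun i => q ∣ a + 2 * i), Finset.filter_filter,
          Finset.filter_filter]
        congr 2
        · ext i
          simp only [Finset.mem_filter, mul_dvd_iff_of_coprime hqD]
          tauto
        · ext i
          simp only [Finset.mem_filter, Finset.mem_insert, forall_eq_or_imp]
          tauto
      rw [Finset.prod_insert hq, Finset.prod_insert hq, Finset.card_insert_of_notMem hq]
      have hsplit' := congrArg (Nat.cast : ℕ → ℝ) hsplit
      push_cast at hsplit' i2 ⊢
      have hq0 : (0 : ℝ) < q := by exact_mod_cast hqp.1.pos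
      have hD0 : (0 : ℝ) < D := by exact_mod_cast hD.pos
      generalize ∏ p ∈ Q, (1 - 1 / (p : ℝ)) = A at *
      generalize ∏ p ∈ Q, (1 + 2 / (p : ℝ)) = B at *
      have e1 : (m : ℝ) / D * ((1 - 1 / q) * A) = m / D * A - m / (q * D) * A := by
        field_simp
      have e2 : (m : ℝ) / D * (1 / 2 ^ (k + 1)) * ((1 + 2 / q) * B)
          = m / D * (1 / 2 ^ (k + 1)) * B + m / (q * D) * (1 / 2 ^ k) * B := by
        rw [pow_succ]; field_simp
      -- The remainder bound is chosen to satisfy the same recursion as the count.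
      have e3 (R : ℝ) : (L : ℝ) ^ (k + 1) * (R * (1 + 1 / L)) = L ^ (k + 1) * R + L ^ k * R := by
        rw [pow_succ]; field_simp
      rw [pow_succ (1 + 1 / (L : ℝ))]
      generalize (1 + 1 / (L : ℝ)) ^ Q.card = R at *
      rw [e1, e2, e3]
      rw [hsplit'] at i1
      rw [abs_le] at i1 i2 ⊢
      constructor <;> linarith [i1.1, i1.2, i2.1, i2.2]

/-! ### The second moment of `∏ p / (p - 1)`. -/

/-- Second moment of `∏ p / (p - 1)` over a progression of difference `2`. -/
theorem sum_prod_sq_le (a m : ℕ) (P : Finset ℕ) :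
    (∀ p ∈ P, p.Prime ∧ Odd p) → ∀ D : ℕ, Odd D → (∀ p ∈ P, Nat.Coprime p D) →
    ∑ i ∈ (Finset.range m).filter (fun i => D ∣ a + 2 * i),
        ∏ p ∈ P.filter (fun p => p ∣ a + 2 * i), ((p : ℝ) / (p - 1)) ^ 2
      ≤ (m : ℝ) / D * ∏ p ∈ P, (1 + (((p : ℝ) / (p - 1)) ^ 2 - 1) / p)
        + ∏ p ∈ P, ((p : ℝ) / (p - 1)) ^ 2 := by
  induction P using Finset.induction_on with
  | empty =>
    intro _ D hD _
    have h := abs_le.1 (abs_card_dvd_sub_le a m D hD)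
    simp
    linarith [h.2]
  | insert q P hq ih =>
    intro hP D hD hcop
    have hP' : ∀ p ∈ P, p.Prime ∧ Odd p := fun p hp => hP p (Finset.mem_insert_of_mem hp)
    have hqp := hP q (Finset.mem_insert_self _ _)
    have hcop' : ∀ p ∈ P, Nat.Coprime p D := fun p hp => hcop p (Finset.mem_insert_of_mem hp)
    have hqD : Nat.Coprime q D := hcop q (Finset.mem_insert_self _ _)
    have i1 := ih hP' D hD hcop'
    have i2 := ih hP' (q * D) (hqp.2.mul hD) fun p hp =>
        Nat.Coprime.mul_right ((Nat.coprime_primes (hP' p hp).1 hqp.1).2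
          fun h => hq (h ▸ hp)) (hcop' p hp)
    have hq1 : (1 : ℝ) < q := by exact_mod_cast hqp.1.one_lt
    have hD0 : (0 : ℝ) < D := by exact_mod_cast hD.pos
    set h : ℝ := ((q : ℝ) / (q - 1)) ^ 2 - 1 with hh
    have hnn : 0 ≤ h := by
      have : 1 ≤ (q : ℝ) / (q - 1) := by rw [le_div_iff₀ (by linarith)]; linarith
      have := one_le_pow₀ (n := 2) this
      linarith
    -- The factor of `q` is `1 + h` if `q` divides the term and `1` otherwise.
    have hsplit : ∑ i ∈ (Finset.range m).filter (fun i => D ∣ a + 2 * i),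
          ∏ p ∈ (insert q P).filter (fun p => p ∣ a + 2 * i), ((p : ℝ) / (p - 1)) ^ 2
        = ∑ i ∈ (Finset.range m).filter (fun i => D ∣ a + 2 * i),
            ∏ p ∈ P.filter (fun p => p ∣ a + 2 * i), ((p : ℝ) / (p - 1)) ^ 2
          + h * ∑ i ∈ (Finset.range m).filter (fun i => q * D ∣ a + 2 * i),
            ∏ p ∈ P.filter (fun p => p ∣ a + 2 * i), ((p : ℝ) / (p - 1)) ^ 2 := by
      have hset : (Finset.range m).filter (fun i => q * D ∣ a + 2 * i)
          = ((Finset.range m).filter (fun i => D ∣ a + 2 * i)).filter (fun i => q ∣ a + 2 * i) := by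
        ext i
        simp only [Finset.mem_filter, mul_dvd_iff_of_coprime hqD]
        tauto
      rw [hset, Finset.sum_filter (fun i => q ∣ a + 2 * i), Finset.mul_sum,
        ← Finset.sum_add_distrib]
      refine Finset.sum_congr rfl fun i _ => ?_
      rw [Finset.filter_insert]
      split_ifs with hqi
      · rw [Finset.prod_insert (by simp [hq]), hh]; ring
      · ring
    rw [hsplit, Finset.prod_insert hq, Finset.prod_insert hq]
    push_cast at i2
    have hqh : ((q : ℝ) / (q - 1)) ^ 2 = 1 + h := by rw [hh]; ring
    rw [hqh, add_sub_cancel_left]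
    generalize ∏ p ∈ P, (1 + (((p : ℝ) / (p - 1)) ^ 2 - 1) / p) = A at *
    generalize ∏ p ∈ P, ((p : ℝ) / (p - 1)) ^ 2 = B at *
    have i3 := mul_le_mul_of_nonneg_left i2 hnn
    have e1 : (m : ℝ) / D * ((1 + h / q) * A) + (1 + h) * B
        = (m / D * A + B) + h * (m / (q * D) * A + B) := by
      field_simp; ring
    rw [e1]
    linarith

/-- The mean of `∏ (p / (p - 1)) ^ 2` over odd primes is less than `1.87`. -/
theorem prod_mean_sq_le (P : Finset ℕ) (hP : ∀ p ∈ P, p.Prime ∧ Odd p) :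
    ∏ p ∈ P, (1 + (((p : ℝ) / (p - 1)) ^ 2 - 1) / p) ≤ 187 / 100 := by
  have hge : ∀ p : ℕ, 2 ≤ p → (1 : ℝ) ≤ 1 + (((p : ℝ) / (p - 1)) ^ 2 - 1) / p := by
    intro p hp
    have hp' : (2 : ℝ) ≤ p := by exact_mod_cast hp
    have : 1 ≤ (p : ℝ) / (p - 1) := by rw [le_div_iff₀ (by linarith)]; linarith
    have := one_le_pow₀ (n := 2) this
    have : 0 ≤ (((p : ℝ) / (p - 1)) ^ 2 - 1) / p := div_nonneg (by linarith) (by linarith)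
    linarith
  -- The primes 3, 5, 7 are computed exactly. The rest are bounded by all odd `2j + 1 ≥ 11`, with
  -- factors at most `j(2j-1)/((j-1)(2j+1))`, which telescope.
  have htail : ∀ J : ℕ, ∏ j ∈ Finset.range J,
      (1 + ((((2 * (j + 5) + 1 : ℕ) : ℝ) / (((2 * (j + 5) + 1 : ℕ) : ℝ) - 1)) ^ 2 - 1)
        / ((2 * (j + 5) + 1 : ℕ) : ℝ)) ≤ 9 / 8 * ((2 * (J : ℝ) + 8) / (2 * J + 9)) := by
    intro J
    induction J with
    | zero => norm_num
    | succ J ih =>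
      rw [Finset.prod_range_succ]
      have h0 := hge (2 * (J + 5) + 1) (by omega)
      refine (mul_le_mul_of_nonneg_right ih (by linarith)).trans ?_
      push_cast
      have hJ : (0 : ℝ) ≤ J := by positivity
      have e : (1 + (((2 * ((J : ℝ) + 5) + 1) / (2 * ((J : ℝ) + 5) + 1 - 1)) ^ 2 - 1)
          / (2 * ((J : ℝ) + 5) + 1)) ≤ 1 + 1 / (2 * (J + 5) ^ 2 - (J + 5) - 1) := by
        have hd : (0 : ℝ) < 2 * (J + 5) ^ 2 - (J + 5) - 1 := by nlinarith
        have e2 : (((2 * ((J : ℝ) + 5) + 1) / (2 * ((J : ℝ) + 5) + 1 - 1)) ^ 2 - 1)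
          / (2 * ((J : ℝ) + 5) + 1) = (4 * (J + 5) + 1) / (4 * (J + 5) ^ 2 * (2 * (J + 5) + 1)) := by
          rw [add_sub_cancel_right]
          field_simp; ring
        rw [e2]
        have := (div_le_div_iff₀ (by positivity : (0 : ℝ) < 4 * (J + 5) ^ 2 * (2 * (J + 5) + 1)) hd
          (a := 4 * ((J : ℝ) + 5) + 1) (c := 1)).2 (by nlinarith [pow_nonneg hJ 3, pow_nonneg hJ 2])
        linarith
      refine (mul_le_mul_of_nonneg_left e (by positivity)).trans (le_of_eq ?_)
      have hd : (2 * ((J : ℝ) + 5) ^ 2 - (J + 5) - 1) = (2 * J + 11) * (J + 4) := by ring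
      rw [hd]
      field_simp; ring
  set F : ℕ → ℝ := fun p => 1 + (((p : ℝ) / (p - 1)) ^ 2 - 1) / p with hF
  obtain ⟨J, hJ⟩ : ∃ J, ∀ p ∈ P, p < J := ⟨P.sup id + 1, fun p hp =>
    Nat.lt_succ_of_le (Finset.le_sup (f := id) hp)⟩
  have hsub : P ⊆ ({3, 5, 7} : Finset ℕ) ∪ (Finset.range J).image fun j => 2 * (j + 5) + 1 := by
    intro p hp
    obtain ⟨hpp, e, rfl⟩ := hP p hp
    have hlt := hJ _ hp
    simp only [Finset.mem_union, Finset.mem_image, Finset.mem_range, Finset.mem_insert,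
      Finset.mem_singleton]
    by_cases he : 5 ≤ e
    · exact Or.inr ⟨e - 5, by omega, by omega⟩
    · left
      interval_cases e <;> revert hpp <;> norm_num
  have hmono : ∏ p ∈ P, F p
      ≤ ∏ p ∈ ({3, 5, 7} : Finset ℕ) ∪ (Finset.range J).image fun j => 2 * (j + 5) + 1, F p := by
    refine Finset.prod_le_prod_of_subset_of_one_le hsub (fun p hp => ?_) (fun p hp _ => ?_)
    · exact zero_le_one.trans (hge p (hP p hp).1.two_le)
    · refine hge p ?_
      simp only [Finset.mem_union, Finset.mem_image, Finset.mem_range, Finset.mem_insert,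
        Finset.mem_singleton] at hp
      omega
  refine hmono.trans ?_
  rw [Finset.prod_union, Finset.prod_image]
  · have h1 : ∏ p ∈ ({3, 5, 7} : Finset ℕ), F p ≤ 1658 / 1000 := by
      simp [hF]; norm_num
    have h2 : ∏ j ∈ Finset.range J, F (2 * (j + 5) + 1) ≤ 9 / 8 := by
      refine (htail J).trans ?_
      have : (2 * (J : ℝ) + 8) / (2 * J + 9) ≤ 1 := by
        rw [div_le_one (by positivity)]; linarith
      linarith
    have h3 : 0 ≤ ∏ j ∈ Finset.range J, F (2 * (j + 5) + 1) :=
      Finset.prod_nonneg fun j _ => zero_le_one.trans (hge _ (by omega))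
    nlinarith
  · intro x _ y _ h
    simpa using h
  · rw [Finset.disjoint_left]
    intro p hp
    simp only [Finset.mem_image, Finset.mem_insert, Finset.mem_singleton] at hp ⊢
    omega

/-! ### Sieve bounds with small relative error. -/

/-- Parameters for which Brun's sieve in progressions of length `m` has relative error at most
`1/100` on integers below `2 ^ L`. -/
structure IsSieveLength (L k m : ℕ) : Prop where
  one_le : 1 ≤ L
  le_two_pow : 200 * (L + 1) ^ 3 ≤ 2 ^ k
  le_length : 1000000 * (L + 1) ^ (k + 1) ≤ m

theorem card_primeFactors_le {x L : ℕ} (hx : x ≠ 0) (hxL : x ≤ 2 ^ L) :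
    x.primeFactors.card ≤ L := by
  have h1 : 2 ^ x.primeFactors.card ≤ ∏ p ∈ x.primeFactors, p :=
    Finset.pow_card_le_prod _ _ _ fun p hp => (Nat.prime_of_mem_primeFactors hp).two_le
  have h2 := Nat.le_of_dvd (Nat.pos_of_ne_zero hx) (Nat.prod_primeFactors_dvd x)
  exact (Nat.pow_le_pow_iff_right (by norm_num)).1 (h1.trans (h2.trans hxL))

theorem coprime_iff_of_odd_add {x y : ℕ} (hx : x ≠ 0) (hxy : Odd (x + y)) :
    Nat.Coprime x y ↔ ∀ p ∈ x.primeFactors.erase 2, ¬ p ∣ y := by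
  rw [Nat.coprime_iff_gcd_eq_one] at *
  constructor
  · intro h p hp hpy
    have hp' := Nat.mem_primeFactors.1 (Finset.mem_of_mem_erase hp)
    exact hp'.1.one_lt.ne' (Nat.dvd_one.1 (h ▸ Nat.dvd_gcd hp'.2.1 hpy))
  · intro h
    refine Nat.Coprime.gcd_eq_one (Nat.coprime_of_dvd fun p hp hpx hpy => ?_)
    rcases eq_or_ne p 2 with rfl | hp2
    · have := dvd_add hpx hpy
      rw [Nat.odd_iff] at hxy
      omega
    · exact h p (Finset.mem_erase.2 ⟨hp2, Nat.mem_primeFactors.2 ⟨hp, hpx, hx⟩⟩) hpy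

theorem odd_of_mem_primeFactors_erase_two {x p : ℕ} (hp : p ∈ x.primeFactors.erase 2) :
    p.Prime ∧ Odd p :=
  ⟨Nat.prime_of_mem_primeFactors (Finset.mem_of_mem_erase hp),
    (Nat.prime_of_mem_primeFactors (Finset.mem_of_mem_erase hp)).odd_of_ne_two
      (Finset.ne_of_mem_erase hp)⟩

/-- Brun's lower bound with relative error `1/100`. -/
theorem IsSieveLength.le_card_sieve {L k m : ℕ} (h : IsSieveLength L k m) (b : ℕ) (Q : Finset ℕ)
    (hQ : ∀ p ∈ Q, p.Prime ∧ Odd p) (hcard : Q.card ≤ L) :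
    99 / 100 * (m * ∏ p ∈ Q, (1 - 1 / (p : ℝ)))
      ≤ (((Finset.range m).filter fun i => ∀ p ∈ Q, ¬ p ∣ b + 2 * i).card : ℝ) := by
  have hs := abs_sieve_sub_le b m L h.one_le Q hQ k 1 odd_one fun p _ => Nat.coprime_one_right p
  simp only [one_dvd, true_and, Nat.cast_one, div_one] at hs
  have hG := inv_card_add_one_le_prod Q fun p hp => (hQ p hp).1.two_le
  have hL : (1 : ℝ) ≤ L := by exact_mod_cast h.one_le
  have hcard' : (Q.card : ℝ) ≤ L := by exact_mod_cast hcard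
  have hGL : 1 / ((L : ℝ) + 1) ≤ ∏ p ∈ Q, (1 - 1 / (p : ℝ)) :=
    (one_div_le_one_div_of_le (by positivity) (by linarith)).trans hG
  have hprod : ∏ p ∈ Q, (1 + 2 / (p : ℝ)) ≤ ((∏ p ∈ Q, (1 - 1 / (p : ℝ)))⁻¹) ^ 2 := by
    rw [← Finset.prod_inv_distrib, ← Finset.prod_pow]
    refine Finset.prod_le_prod (fun p _ => by positivity) fun p hp => ?_
    have hp2 : (2 : ℝ) ≤ p := by exact_mod_cast (hQ p hp).1.two_le
    have h1 : (1 - 1 / (p : ℝ))⁻¹ = 1 + 1 / (p - 1) := by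
      have : (p : ℝ) - 1 ≠ 0 := by linarith
      have h3 : (1 - 1 / (p : ℝ)) = (p - 1) / p := by field_simp
      rw [h3]
      field_simp; ring
    have h2 : 1 / (p : ℝ) ≤ 1 / (p - 1) := one_div_le_one_div_of_le (by linarith) (by linarith)
    have h4 : 2 / (p : ℝ) = 2 * (1 / p) := by ring
    rw [h1, h4]
    nlinarith [sq_nonneg (1 / ((p : ℝ) - 1))]
  set G := ∏ p ∈ Q, (1 - 1 / (p : ℝ)) with hGdef
  have hG0 : 0 < G := lt_of_lt_of_le (by positivity) hGL
  have hGinv : (G⁻¹) ^ 2 ≤ ((L : ℝ) + 1) ^ 2 := by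
    refine pow_le_pow_left₀ (by positivity) ?_ 2
    rw [inv_le_comm₀ hG0 (by positivity), ← one_div]
    exact hGL
  have hpow : (1 + 1 / (L : ℝ)) ^ Q.card ≤ 3 := by
    have h1 : (1 + 1 / (L : ℝ)) ^ Q.card ≤ (1 + 1 / (L : ℝ)) ^ L :=
      pow_le_pow_right₀ (by have : (0 : ℝ) ≤ 1 / L := by positivity
                            linarith) hcard
    have h2 : (1 + 1 / (L : ℝ)) ^ L ≤ Real.exp 1 := by
      have h3 : 1 + 1 / (L : ℝ) ≤ Real.exp (1 / L) := by
        have := Real.add_one_le_exp (1 / (L : ℝ)); linarith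
      refine (pow_le_pow_left₀ (by positivity) h3 L).trans (le_of_eq ?_)
      rw [← Real.exp_nat_mul]
      congr 1
      field_simp
    have := Real.exp_one_lt_three
    linarith
  have hk : 200 * ((L : ℝ) + 1) ^ 3 ≤ 2 ^ k := by exact_mod_cast h.le_two_pow
  have hm : 1000000 * ((L : ℝ) + 1) ^ (k + 1) ≤ m := by exact_mod_cast h.le_length
  have hm0 : (0 : ℝ) ≤ m := by positivity
  -- The main term is at least `m / (L + 1)`, so each of the two errors may be `m / (200 * (L +
  -- 1))`. The cube in `le_two_pow` pays for this `L + 1` and for `∏ (1 + 2/p) ≤ (L + 1) ^ 2`.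
  have e1 : (m : ℝ) * (1 / 2 ^ k) * ∏ p ∈ Q, (1 + 2 / (p : ℝ)) ≤ m / 200 * (1 / ((L : ℝ) + 1)) := by
    calc (m : ℝ) * (1 / 2 ^ k) * ∏ p ∈ Q, (1 + 2 / (p : ℝ))
        ≤ m * (1 / (200 * ((L : ℝ) + 1) ^ 3)) * ((L : ℝ) + 1) ^ 2 := by
          refine mul_le_mul ?_ (hprod.trans hGinv)
            (Finset.prod_nonneg fun p _ => by positivity) (by positivity)
          exact mul_le_mul_of_nonneg_left (one_div_le_one_div_of_le (by positivity) hk) hm0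
      _ = _ := by field_simp
  have e2 : (L : ℝ) ^ k * (1 + 1 / (L : ℝ)) ^ Q.card ≤ m / 200 * (1 / ((L : ℝ) + 1)) := by
    have h1 : (L : ℝ) ^ k ≤ (L + 1) ^ k := pow_le_pow_left₀ (by linarith) (by linarith) k
    have h2 : (L : ℝ) ^ k * (1 + 1 / (L : ℝ)) ^ Q.card ≤ (L + 1) ^ k * 3 :=
      mul_le_mul h1 hpow (by positivity) (by positivity)
    refine h2.trans ?_
    rw [mul_one_div, le_div_iff₀ (by positivity)]
    rw [pow_succ] at hm
    have h3 : 0 < ((L : ℝ) + 1) ^ k * (L + 1) := by positivity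
    linarith
  have e3 : (m : ℝ) / 200 * (1 / ((L : ℝ) + 1)) ≤ m / 200 * G :=
    mul_le_mul_of_nonneg_left hGL (by positivity)
  have := (abs_le.1 hs).1
  linarith

/-- Discarding the primes `≥ 100 L` from a product over at most `L` primes. -/
theorem le_prod_of_card_le (Q : Finset ℕ) (L : ℕ) (hL : 1 ≤ L) (hcard : Q.card ≤ L)
    (hQ : ∀ p ∈ Q, 2 ≤ p) :
    99 / 100 * ∏ p ∈ Q.filter (fun p => p < 100 * L), (1 - 1 / (p : ℝ))
      ≤ ∏ p ∈ Q, (1 - 1 / (p : ℝ)) := by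
  have hL' : (1 : ℝ) ≤ L := by exact_mod_cast hL
  have hfac : ∀ p ∈ Q, (0 : ℝ) ≤ 1 - 1 / (p : ℝ) := fun p hp => by
    have : (2 : ℝ) ≤ p := by exact_mod_cast hQ p hp
    rw [sub_nonneg, div_le_one (by linarith)]; linarith
  rw [← Finset.prod_filter_mul_prod_filter_not Q (fun p => p < 100 * L), mul_comm (99 / 100 : ℝ)]
  refine mul_le_mul_of_nonneg_left ?_ (Finset.prod_nonneg fun p hp =>
    hfac p (Finset.mem_of_mem_filter p hp))
  set R := Q.filter (fun p => ¬ p < 100 * L) with hR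
  have hz1 : (1 : ℝ) / (100 * L) ≤ 1 := by rw [div_le_one (by positivity)]; linarith
  have h1 : (1 - 1 / (100 * (L : ℝ))) ^ R.card ≤ ∏ p ∈ R, (1 - 1 / (p : ℝ)) := by
    rw [← Finset.prod_const]
    refine Finset.prod_le_prod (fun p _ => by linarith) fun p hp => ?_
    have hp' : 100 * (L : ℝ) ≤ p := by
      have := (Finset.mem_filter.1 hp).2
      exact_mod_cast not_lt.1 this
    have := one_div_le_one_div_of_le (by positivity) hp'
    linarith
  have h2 := one_add_mul_le_pow (a := -(1 / (100 * (L : ℝ)))) (by linarith) R.card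
  have h3 : (R.card : ℝ) ≤ L := by exact_mod_cast (Finset.card_filter_le _ _).trans hcard
  have h4 : (R.card : ℝ) * (1 / (100 * (L : ℝ))) ≤ 1 / 100 := by
    rw [mul_one_div, div_le_div_iff₀ (by positivity) (by positivity)]; linarith
  rw [← sub_eq_add_neg] at h2
  linarith

/-! ### Coprime pairs between two progressions or intervals. -/

/-- A set of at most half of a progression contains an element which is coprime to at least as many
elements of a progression of opposite parity. -/
theorem IsSieveLength.exists_card_le_card_coprime {L k m : ℕ} (h : IsSieveLength L k m) {a b : ℕ}
    (ha : 0 < a) (haL : a + 2 * m ≤ 2 ^ L) (hab : Odd (a + b)) (S : Finset ℕ)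
    (hS : S ⊆ Finset.range m) (hS0 : S.Nonempty) (hS2 : 2 * S.card ≤ m + 1) :
    ∃ s ∈ S, S.card ≤
      ((Finset.range m).filter fun j => Nat.Coprime (a + 2 * s) (b + 2 * j)).card := by
  by_contra! hcon
  have hL : (1 : ℝ) ≤ L := by exact_mod_cast h.one_le
  have hm : 1000000 * ((L : ℝ) + 1) ^ (k + 1) ≤ m := by exact_mod_cast h.le_length
  have hk : 1 ≤ k := by
    by_contra hk
    have h1 := h.le_two_pow
    have h2 : 1 ≤ (L + 1) ^ 3 := Nat.one_le_pow _ _ (by omega)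
    interval_cases k
    omega
  have hm2 : 1000000 * (L : ℝ) ^ 2 ≤ m := by
    have h1 : ((L : ℝ) + 1) ^ 2 ≤ ((L : ℝ) + 1) ^ (k + 1) :=
      pow_le_pow_right₀ (by linarith) (by omega)
    nlinarith
  have hm6 : (1000000 : ℝ) ≤ m := by nlinarith
  have hc0 : (0 : ℝ) < S.card := by exact_mod_cast hS0.card_pos
  set c : ℝ := (S.card : ℝ) with hc
  have hc2 : 2 * c ≤ m + 1 := by rw [hc]; exact_mod_cast hS2
  set P : Finset ℕ := (Finset.range (100 * L)).filter fun p => p.Prime ∧ Odd p with hP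
  have hPp : ∀ p ∈ P, p.Prime ∧ Odd p := fun p hp => (Finset.mem_filter.1 hp).2
  -- `9801 / 10000 = (99 / 100) ^ 2`: one factor is lost in the sieve, one in discarding primes `≥
  -- 100 L`. The discarding keeps the remainder of the second moment below `(100 L) ^ 2`.
  have hpoint : ∀ s ∈ S, (9801 / 10000 * m / c) ^ 2
      ≤ ∏ p ∈ P.filter (fun p => p ∣ a + 2 * s), ((p : ℝ) / (p - 1)) ^ 2 := by
    intro s hs
    have hsm := Finset.mem_range.1 (hS hs)
    have hx : a + 2 * s ≠ 0 := by omega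
    set Q := (a + 2 * s).primeFactors.erase 2 with hQ
    have hQc : Q.card ≤ L :=
      (Finset.card_erase_le).trans (card_primeFactors_le hx (by omega))
    have hQp : ∀ p ∈ Q, p.Prime ∧ Odd p := fun p hp => odd_of_mem_primeFactors_erase_two hp
    have h1 := h.le_card_sieve b Q hQp hQc
    have h2 := le_prod_of_card_le Q L h.one_le hQc fun p hp => (hQp p hp).1.two_le
    have h3 : (((Finset.range m).filter fun i => ∀ p ∈ Q, ¬ p ∣ b + 2 * i).card : ℝ) ≤ c := by
      have h4 := hcon s hs
      have h5 : ∀ j, Nat.Coprime (a + 2 * s) (b + 2 * j) ↔ ∀ p ∈ Q, ¬ p ∣ b + 2 * j := fun j =>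
        coprime_iff_of_odd_add hx (by
          rw [Nat.odd_iff] at hab ⊢; omega)
      simp only [h5] at h4
      rw [hc]
      exact Nat.cast_le.2 h4.le
    have hset : Q.filter (fun p => p < 100 * L) = P.filter (fun p => p ∣ a + 2 * s) := by
      ext p
      simp only [hQ, hP, Finset.mem_filter, Finset.mem_erase, Nat.mem_primeFactors,
        Finset.mem_range]
      constructor
      · rintro ⟨⟨hp2, hp, hpd, -⟩, hlt⟩
        exact ⟨⟨hlt, hp, hp.odd_of_ne_two hp2⟩, hpd⟩
      · rintro ⟨⟨hlt, hp, hodd⟩, hpd⟩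
        refine ⟨⟨?_, hp, hpd, hx⟩, hlt⟩
        rintro rfl
        exact absurd hodd (by decide)
    rw [hset] at h2
    set T := P.filter (fun p => p ∣ a + 2 * s) with hT
    have hTp : ∀ p ∈ T, (2 : ℝ) ≤ p := fun p hp => by
      exact_mod_cast (hPp p (Finset.mem_of_mem_filter p hp)).1.two_le
    have hinv : ∏ p ∈ T, ((p : ℝ) / (p - 1)) ^ 2 = ((∏ p ∈ T, (1 - 1 / (p : ℝ)))⁻¹) ^ 2 := by
      rw [← Finset.prod_inv_distrib, ← Finset.prod_pow]
      refine Finset.prod_congr rfl fun p hp => ?_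
      have := hTp p hp
      congr 1
      rw [one_sub_div (by linarith), inv_div]
    have hpos : 0 < ∏ p ∈ T, (1 - 1 / (p : ℝ)) := Finset.prod_pos fun p hp => by
      have := hTp p hp
      rw [sub_pos, div_lt_one (by linarith)]; linarith
    rw [hinv]
    refine pow_le_pow_left₀ (by positivity) ?_ 2
    rw [div_le_iff₀ hc0, ← div_eq_inv_mul, le_div_iff₀ hpos]
    have h6 := mul_le_mul_of_nonneg_left h2 (by positivity : (0 : ℝ) ≤ 99 / 100 * m)
    linarith
  have hsum : c * (9801 / 10000 * m / c) ^ 2 ≤ ∑ i ∈ Finset.range m,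
      ∏ p ∈ P.filter (fun p => p ∣ a + 2 * i), ((p : ℝ) / (p - 1)) ^ 2 := by
    refine le_trans ?_ (Finset.sum_le_sum_of_subset_of_nonneg hS fun i _ _ =>
      Finset.prod_nonneg fun p _ => by positivity)
    rw [hc, ← nsmul_eq_mul]
    exact Finset.card_nsmul_le_sum _ _ _ hpoint
  have hmom := sum_prod_sq_le a m P hPp 1 odd_one fun p _ => Nat.coprime_one_right p
  simp only [one_dvd, Finset.filter_true, Nat.cast_one, div_one] at hmom
  have hmean := mul_le_mul_of_nonneg_left (prod_mean_sq_le P hPp) (by positivity : (0 : ℝ) ≤ m)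
  have hrem : ∏ p ∈ P, ((p : ℝ) / (p - 1)) ^ 2 ≤ (100 * (L : ℝ)) ^ 2 := by
    have hPc : (P.card : ℝ) + 1 ≤ 100 * L := by
      have h1 : P ⊆ (Finset.range (100 * L)).erase 0 := fun p hp =>
        Finset.mem_erase.2 ⟨(hPp p hp).1.ne_zero, Finset.mem_of_mem_filter p hp⟩
      have h2 := Finset.card_le_card h1
      rw [Finset.card_erase_of_mem (Finset.mem_range.2 (by have := h.one_le; omega)),
        Finset.card_range] at h2
      have h3 : P.card + 1 ≤ 100 * L := by have := h.one_le; omega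
      exact_mod_cast h3
    have hG := inv_card_add_one_le_prod P fun p hp => (hPp p hp).1.two_le
    rw [Finset.prod_pow]
    refine pow_le_pow_left₀ (Finset.prod_nonneg fun p hp => ?_) ?_ 2
    · have : (2 : ℝ) ≤ p := by exact_mod_cast (hPp p hp).1.two_le
      exact div_nonneg (by linarith) (by linarith)
    have hinv : ∏ p ∈ P, ((p : ℝ) / (p - 1)) = (∏ p ∈ P, (1 - 1 / (p : ℝ)))⁻¹ := by
      rw [← Finset.prod_inv_distrib]
      refine Finset.prod_congr rfl fun p hp => ?_
      have : (2 : ℝ) ≤ p := by exact_mod_cast (hPp p hp).1.two_le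
      rw [one_sub_div (by linarith), inv_div]
    rw [hinv]
    refine le_trans ?_ hPc
    rw [inv_le_comm₀ (lt_of_lt_of_le (by positivity) hG) (by positivity), ← one_div]
    exact hG
  -- The remainder `(100 L) ^ 2` is at most `m / 100`. The contradiction then comes from `0.9801 ^ 2
  -- > 1.88 / 2` and `2 * c ≤ m + 1`.
  have hfin : c * (9801 / 10000 * m / c) ^ 2 ≤ 188 / 100 * m := by nlinarith
  have heq : c * (9801 / 10000 * m / c) ^ 2 = (9801 / 10000 * m) ^ 2 / c := by
    field_simp
  rw [heq, div_le_iff₀ hc0] at hfin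
  nlinarith

/-- If one of the sets is at most half, it has an element coprime to at least as many terms of the
other progression as the set has elements, and the other set must avoid all of these. -/
theorem IsSieveLength.card_add_card_le {L k m : ℕ} (h : IsSieveLength L k m) {a b : ℕ}
    (ha : 0 < a) (haL : a + 2 * m ≤ 2 ^ L) (hb : 0 < b) (hbL : b + 2 * m ≤ 2 ^ L)
    (hab : Odd (a + b)) (S T : Finset ℕ)
    (hS : S ⊆ Finset.range m) (hT : T ⊆ Finset.range m)
    (hST : ∀ s ∈ S, ∀ t ∈ T, ¬ Nat.Coprime (a + 2 * s) (b + 2 * t)) :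
    S.card + T.card ≤ m := by
  have key : ∀ (a b : ℕ), 0 < a → a + 2 * m ≤ 2 ^ L → Odd (a + b) → ∀ S T : Finset ℕ,
      S ⊆ Finset.range m → T ⊆ Finset.range m →
      (∀ s ∈ S, ∀ t ∈ T, ¬ Nat.Coprime (a + 2 * s) (b + 2 * t)) → 2 * S.card ≤ m + 1 →
      S.card + T.card ≤ m := by
    intro a b ha haL hab S T hS hT hST hS2
    have hTm := Finset.card_le_card hT
    rw [Finset.card_range] at hTm
    rcases S.eq_empty_or_nonempty with rfl | hS0
    · simpa using hTm
    obtain ⟨s, hs, hle⟩ := h.exists_card_le_card_coprime ha haL hab S hS hS0 hS2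
    have hdisj : Disjoint
        ((Finset.range m).filter fun j => Nat.Coprime (a + 2 * s) (b + 2 * j)) T := by
      rw [Finset.disjoint_left]
      intro j hj hjT
      exact hST s hs j hjT (Finset.mem_filter.1 hj).2
    have hu := Finset.card_le_card (Finset.union_subset (Finset.filter_subset
      (fun j => Nat.Coprime (a + 2 * s) (b + 2 * j)) (Finset.range m)) hT)
    rw [Finset.card_union_of_disjoint hdisj, Finset.card_range] at hu
    omega
  by_cases h1 : 2 * S.card ≤ m + 1
  · exact key a b ha haL hab S T hS hT hST h1
  by_cases h2 : 2 * T.card ≤ m + 1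
  · have := key b a hb hbL (by rwa [add_comm]) T S hT hS
      (fun t ht s hs hc => hST s hs t ht hc.symm) h2
    omega
  -- Both sets exceed half: shrinking `S` to half already contradicts the size of `T`.
  obtain ⟨S', hS', hc⟩ := Finset.exists_subset_card_eq (show (m + 1) / 2 ≤ S.card by omega)
  have := key a b ha haL hab S' T (hS'.trans hS) hT (fun s hs => hST s (hS' hs)) (by omega)
  omega

theorem card_filter_Ioc_eq (X : Finset ℕ) (p m : ℕ) :
    ((Finset.Ioc p (p + 2 * m)).filter (· ∈ X)).card
      = ((Finset.range m).filter fun i => p + 1 + 2 * i ∈ X).card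
        + ((Finset.range m).filter fun i => p + 2 + 2 * i ∈ X).card := by
  simp only [Finset.card_filter]
  induction m with
  | zero => simp
  | succ m ih =>
    have e : p + 2 * (m + 1) = p + 2 * m + 1 + 1 := by ring
    rw [e, Finset.sum_Ioc_succ_top (by omega), Finset.sum_Ioc_succ_top (by omega), ih,
      Finset.sum_range_succ, Finset.sum_range_succ]
    have e1 : p + 2 * m + 1 = p + 1 + 2 * m := by ring
    have e2 : p + 2 * m + 1 + 1 = p + 2 + 2 * m := by ring
    rw [e2, e1]
    ring

/-- A set without coprime pairs between two intervals of length `2 m` contains at most half of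
their elements. -/
theorem IsSieveLength.card_filter_Ioc_add_le {L k m : ℕ} (h : IsSieveLength L k m) (p q : ℕ)
    (hp : p + 2 + 2 * m ≤ 2 ^ L) (hq : q + 2 + 2 * m ≤ 2 ^ L) (X : Finset ℕ)
    (hX : ∀ x ∈ X, ∀ y ∈ X, p < x → x ≤ p + 2 * m → q < y → y ≤ q + 2 * m → ¬ Nat.Coprime x y) :
    ((Finset.Ioc p (p + 2 * m)).filter (· ∈ X)).card
      + ((Finset.Ioc q (q + 2 * m)).filter (· ∈ X)).card ≤ 2 * m := by
  rw [card_filter_Ioc_eq, card_filter_Ioc_eq]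
  have key : ∀ u v : ℕ, 1 ≤ u → u ≤ 2 → 1 ≤ v → v ≤ 2 → Odd (p + u + (q + v)) →
      ((Finset.range m).filter fun i => p + u + 2 * i ∈ X).card
        + ((Finset.range m).filter fun i => q + v + 2 * i ∈ X).card ≤ m := by
    intro u v hu1 hu2 hv1 hv2 hodd
    refine h.card_add_card_le (a := p + u) (b := q + v) (by omega) (by omega) (by omega) (by omega)
      hodd _ _ (Finset.filter_subset _ _) (Finset.filter_subset _ _) ?_
    intro s hs t ht
    rw [Finset.mem_filter, Finset.mem_range] at hs ht
    exact hX _ hs.2 _ ht.2 (by omega) (by omega) (by omega) (by omega)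
  rcases Nat.even_or_odd (p + q) with he | ho
  · have k1 := key 1 2 le_rfl (by omega) (by omega) le_rfl (by
      rw [Nat.even_iff] at he; rw [Nat.odd_iff]; omega)
    have k2 := key 2 1 (by omega) le_rfl le_rfl (by omega) (by
      rw [Nat.even_iff] at he; rw [Nat.odd_iff]; omega)
    omega
  · have k1 := key 1 1 le_rfl (by omega) le_rfl (by omega) (by
      rw [Nat.odd_iff] at ho ⊢; omega)
    have k2 := key 2 2 (by omega) le_rfl (by omega) le_rfl (by
      rw [Nat.odd_iff] at ho ⊢; omega)
    omega

theorem IsSieveLength.exists_coprime {L k m : ℕ} (h : IsSieveLength L k m) {x q : ℕ}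
    (hx : 0 < x) (hxL : x + 2 * m ≤ 2 ^ L) :
    ∃ y, q < y ∧ y ≤ q + 2 * m ∧ Nat.Coprime x y := by
  have hm : 1 ≤ m := le_trans (Nat.mul_pos (by norm_num) (Nat.pow_pos (Nat.succ_pos L))) h.le_length
  have key : ∀ u, 1 ≤ u → u ≤ 2 → Odd (x + (q + u)) →
      ∃ y, q < y ∧ y ≤ q + 2 * m ∧ Nat.Coprime x y := by
    intro u hu1 hu2 hodd
    obtain ⟨s, hs, hle⟩ := h.exists_card_le_card_coprime hx hxL hodd {0}
      (by simpa using Nat.pos_of_ne_zero (by omega)) (by simp) (by simpa using by omega)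
    rw [Finset.mem_singleton] at hs
    subst hs
    obtain ⟨j, hj⟩ := Finset.card_pos.1 (lt_of_lt_of_le (by simp) hle)
    rw [Finset.mem_filter, Finset.mem_range] at hj
    exact ⟨q + u + 2 * j, by omega, by omega, by simpa using hj.2⟩
  rcases Nat.even_or_odd (x + q) with he | ho
  · exact key 1 le_rfl (by omega) (by rw [Nat.even_iff] at he; rw [Nat.odd_iff]; omega)
  · exact key 2 (by omega) le_rfl (by rw [Nat.odd_iff] at ho ⊢; omega)

/-! ### Explicit times from missing speeds. -/

namespace LonelyRunner

theorem fract_mem_of_eq_add {n : ℕ} {q f : ℝ} (z : ℕ) (h : q = z + f)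
    (h1 : (1 : ℝ) / (n + 1) < f) (h2 : f < (n : ℝ) / (n + 1)) :
    (1 : ℝ) / (n + 1) < Int.fract q ∧ Int.fract q < (n : ℝ) / (n + 1) := by
  have hn : (n : ℝ) / (n + 1) < 1 := by rw [div_lt_one (by positivity)]; linarith
  have hf : Int.fract q = f := by
    rw [h, Int.fract_natCast_add, Int.fract_eq_self]
    exact ⟨le_trans (by positivity) h1.le, h2.trans hn⟩
  rw [hf]
  exact ⟨h1, h2⟩

theorem mul_div_eq_add_mod (v c s : ℕ) (hs : 0 < s) :
    (v : ℝ) * (c / s) = ((v * c / s : ℕ) : ℝ) + ((v * c % s : ℕ) : ℝ) / s := by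
  have h := congrArg (Nat.cast : ℕ → ℝ) (Nat.div_add_mod (v * c) s)
  have hs' : (0 : ℝ) < s := by exact_mod_cast hs
  push_cast at h
  field_simp
  linarith

/-- At the time `c / s` it suffices to look at the residues `v i * c % s`. -/
theorem exists_time_of_mod {n : ℕ} (v : Fin n → ℕ) (c s : ℕ) (hs : 0 < s)
    (h : ∀ i, s < (v i * c % s) * (n + 1) ∧ (v i * c % s) * (n + 1) < n * s) :
    ∃ t : ℝ, ∀ i : Fin n, (1 : ℝ) / (n + 1) < Int.fract ((v i : ℝ) * t) ∧
        Int.fract ((v i : ℝ) * t) < (n : ℝ) / (n + 1) := by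
  refine ⟨c / s, fun i => fract_mem_of_eq_add _ (mul_div_eq_add_mod (v i) c s hs) ?_ ?_⟩
  · have hs' : (0 : ℝ) < s := by exact_mod_cast hs
    rw [div_lt_div_iff₀ (by positivity) hs']
    have := (h i).1
    rw [one_mul]
    exact_mod_cast this
  · have hs' : (0 : ℝ) < s := by exact_mod_cast hs
    rw [div_lt_div_iff₀ hs' (by positivity)]
    exact_mod_cast (h i).2

/-- If no speed is divisible by `m ≤ n`, the instance is loose. -/
theorem exists_time_of_not_dvd {n : ℕ} (v : Fin n → ℕ) (m : ℕ) (hm : 0 < m) (hmn : m ≤ n)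
    (h : ∀ i, ¬ m ∣ v i) :
    ∃ t : ℝ, ∀ i : Fin n, (1 : ℝ) / (n + 1) < Int.fract ((v i : ℝ) * t) ∧
        Int.fract ((v i : ℝ) * t) < (n : ℝ) / (n + 1) := by
  refine exists_time_of_mod v 1 m hm fun i => ?_
  rw [mul_one]
  have h1 : 0 < v i % m := Nat.pos_of_ne_zero fun h0 => h i (Nat.dvd_of_mod_eq_zero h0)
  have h2 := Nat.mod_lt (v i) hm
  generalize v i % m = r at *
  obtain ⟨d, rfl⟩ := Nat.exists_eq_add_of_lt h2
  constructor <;> nlinarith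

/-- Two missing coprime speeds whose sum exceeds all speeds but not `2 n + 1` make the instance
loose. -/
theorem exists_time_of_coprime_pair {n : ℕ} (v : Fin n → ℕ) (hv : ∀ i, 0 < v i) (x y : ℕ)
    (hxy : Nat.Coprime x y) (hsum : ∀ i, v i < x + y) (hle : x + y ≤ 2 * n + 1)
    (hx0 : 0 < x) (hy0 : 0 < y) (hx : ∀ i, v i ≠ x) (hy : ∀ i, v i ≠ y) :
    ∃ t : ℝ, ∀ i : Fin n, (1 : ℝ) / (n + 1) < Int.fract ((v i : ℝ) * t) ∧
        Int.fract ((v i : ℝ) * t) < (n : ℝ) / (n + 1) := by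
  obtain ⟨s, hs⟩ : ∃ s, s = x + y := ⟨_, rfl⟩
  have hcop : Nat.Coprime x s := by rw [hs]; simpa using hxy
  obtain ⟨c, -, hc⟩ := Nat.exists_mul_mod_eq_one_of_coprime hcop (by omega)
  refine exists_time_of_mod v c s (by omega) fun i => ?_
  have hvs : v i < s := hs ▸ hsum i
  -- As `c` inverts `x` and `y ≡ -x`, the residues 0, 1, -1 could come only from multiples of `s`,
  -- from `x` and from `y`. The other residues suffice because `2 / s > 1 / (n + 1)`.
  have hmod : v i ≡ (v i * c % s) * x [MOD s] := by
    have h1 : x * c ≡ 1 [MOD s] := by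
      rw [Nat.ModEq, hc, Nat.mod_eq_of_lt (by omega)]
    calc v i = v i * 1 := (mul_one _).symm
      _ ≡ v i * (x * c) [MOD s] := (h1.symm).mul_left _
      _ = v i * c * x := by ring
      _ ≡ (v i * c % s) * x [MOD s] := ((Nat.mod_modEq _ _).symm).mul_right _
  have hlt := Nat.mod_lt (v i * c) (show 0 < s by omega)
  generalize v i * c % s = r at *
  have hr0 : r ≠ 0 := by
    rintro rfl
    rw [zero_mul] at hmod
    exact (hv i).ne' (hmod.eq_of_lt_of_lt hvs (by omega))
  have hr1 : r ≠ 1 := by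
    rintro rfl
    rw [one_mul] at hmod
    exact hx i (hmod.eq_of_lt_of_lt hvs (by omega))
  have hr2 : r + 1 ≠ s := by
    intro hr
    refine hy i (Nat.ModEq.eq_of_lt_of_lt (m := s) ?_ hvs (by omega))
    refine Nat.ModEq.add_right_cancel' x ((hmod.add_right x).trans ?_)
    have e : r * x + x = s * x := by rw [← hr]; ring
    rw [e, add_comm y x, ← hs]
    exact (Nat.modEq_zero_iff_dvd.2 ⟨x, rfl⟩).trans (Nat.modEq_zero_iff_dvd.2 dvd_rfl).symm
  obtain ⟨d, rfl⟩ := Nat.exists_eq_add_of_lt (show r + 1 < s by omega)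
  constructor <;> nlinarith [show 2 ≤ r by omega]

/-- A missing speed `x` makes the instance loose if some `y` coprime to `x` is such that all speeds
are less than `x + y` and `y + 2 x ≤ 2 n + 1`. -/
theorem exists_time_of_missing {n : ℕ} (v : Fin n → ℕ) (hv : ∀ i, 0 < v i) (x y : ℕ)
    (hx0 : 0 < x) (hxn : x ≤ n) (hxy : Nat.Coprime x y) (hsum : ∀ i, v i < y + x)
    (hle : y + 2 * x ≤ 2 * n + 1) (hv2 : ∀ i, v i < 2 * n) (hx : ∀ i, v i ≠ x) :
    ∃ t : ℝ, ∀ i : Fin n, (1 : ℝ) / (n + 1) < Int.fract ((v i : ℝ) * t) ∧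
        Int.fract ((v i : ℝ) * t) < (n : ℝ) / (n + 1) := by
  -- At time `c / x` the residue `-1` belongs exactly to speeds congruent to `y`; having `v i < y +
  -- x`, these are at most `y`, so the forward shift does not carry them too far.
  obtain ⟨c, hc⟩ : ∃ c, y * c + 1 ≡ 0 [MOD x] := by
    rcases Nat.lt_or_ge 1 x with h1 | h1
    · obtain ⟨c, -, hc⟩ := Nat.exists_mul_mod_eq_one_of_coprime hxy.symm h1
      refine ⟨c * (x - 1), ?_⟩
      have h2 : y * c ≡ 1 [MOD x] := by rw [Nat.ModEq, hc, Nat.mod_eq_of_lt h1]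
      have h3 := (h2.mul_right (x - 1)).add_right 1
      rw [mul_assoc, one_mul, Nat.sub_add_cancel h1.le] at h3
      exact h3.trans (Nat.modEq_zero_iff_dvd.2 dvd_rfl)
    · obtain rfl : x = 1 := by omega
      exact ⟨0, Nat.modEq_one⟩
  have hxr : (0 : ℝ) < x := by exact_mod_cast hx0
  have key : ∀ i, 4 * x * (n + 1) < 4 * (v i * c % x) * (n + 1) ^ 2 + v i * (2 * (n + 1) + 1) ∧
      4 * (v i * c % x) * (n + 1) ^ 2 + v i * (2 * (n + 1) + 1) < 4 * x * (n + 1) * n := by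
    intro i
    have hmod : (v i * c % x) * y + v i ≡ 0 [MOD x] := by
      have h1 := hc.mul_left (v i)
      have h2 : (v i * c % x) * y + v i ≡ v i * c * y + v i [MOD x] :=
        ((Nat.mod_modEq _ _).mul_right y).add_right _
      have e : v i * c * y + v i = v i * (y * c + 1) := by ring
      rw [e] at h2
      simpa using h2.trans h1
    have hlt := Nat.mod_lt (v i * c) hx0
    have hvi := hv2 i
    have hvp := hv i
    generalize v i * c % x = r at *
    rcases Nat.eq_zero_or_pos r with rfl | hr
    · rw [zero_mul, zero_add, Nat.modEq_zero_iff_dvd] at hmod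
      obtain ⟨d, hd⟩ := hmod
      have hd2 : 2 ≤ d := by
        by_contra hd2
        interval_cases d
        · omega
        · exact hx i (by omega)
      have hv2x : 2 * x ≤ v i := by rw [hd]; nlinarith
      constructor
      · nlinarith
      · have h1 : v i + 1 ≤ 2 * n := hvi
        have h2 : (v i + 1) * (2 * n + 3) ≤ 2 * n * (2 * n + 3) := Nat.mul_le_mul_right _ h1
        have h3 : 1 * ((n + 1) * n) ≤ x * ((n + 1) * n) := Nat.mul_le_mul_right _ hx0
        nlinarith
    · refine ⟨by nlinarith, ?_⟩
      rcases Nat.lt_or_ge (r + 1) x with hrx | hrx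
      · have h1 : v i + 1 ≤ 2 * n := hvi
        have h2 : (r + 2) * (n + 1) ^ 2 ≤ x * (n + 1) ^ 2 := Nat.mul_le_mul_right _ hrx
        nlinarith
      · have hrx' : r + 1 = x := by omega
        have hvy : v i ≤ y := by
          by_contra hlt'
          have h1 : y ≡ v i [MOD x] := by
            refine Nat.ModEq.add_left_cancel' (r * y) (Nat.ModEq.trans ?_ hmod.symm)
            have e : r * y + y = x * y := by rw [← hrx']; ring
            rw [e]
            exact Nat.modEq_zero_iff_dvd.2 ⟨y, rfl⟩
          have h2 := (Nat.modEq_iff_dvd' (by omega)).1 h1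
          have h3 := Nat.le_of_dvd (by omega) h2
          have := hsum i
          omega
        have h3 : (v i + 2 * x) * (2 * n + 3) ≤ (2 * n + 1) * (2 * n + 3) :=
          Nat.mul_le_mul_right _ (by omega)
        subst hrx'
        nlinarith
  -- Slightly more than `1 / (2 * x * (n + 1))`: this moves multiples of `x` from `2 * x` on past `1
  -- / (n + 1)`, while speeds below `2 * n` move by less than `1 / x`.
  set ε : ℝ := (2 * ((n : ℝ) + 1) + 1) / (4 * x * (n + 1) ^ 2) with hε
  refine ⟨c / x + ε, fun i => ?_⟩
  have hk1 : 4 * (x : ℝ) * (n + 1)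
      < 4 * ((v i * c % x : ℕ) : ℝ) * (n + 1) ^ 2 + v i * (2 * (n + 1) + 1) := by
    exact_mod_cast (key i).1
  have hk2 : 4 * ((v i * c % x : ℕ) : ℝ) * (n + 1) ^ 2 + v i * (2 * (n + 1) + 1)
      < 4 * (x : ℝ) * (n + 1) * n := by
    exact_mod_cast (key i).2
  have hf : ((v i * c % x : ℕ) : ℝ) / x + v i * ε
      = (4 * ((v i * c % x : ℕ) : ℝ) * (n + 1) ^ 2 + v i * (2 * (n + 1) + 1))
        / (4 * x * (n + 1) ^ 2) := by
    rw [hε]; field_simp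
  refine fract_mem_of_eq_add (f := ((v i * c % x : ℕ) : ℝ) / x + v i * ε) (v i * c / x) ?_ ?_ ?_
  · rw [mul_add, mul_div_eq_add_mod _ _ _ hx0, add_assoc]
  · rw [hf, div_lt_div_iff₀ (by positivity) (by positivity)]
    have := mul_lt_mul_of_pos_right hk1 (by positivity : (0 : ℝ) < n + 1)
    linarith
  · rw [hf, div_lt_div_iff₀ (by positivity) (by positivity)]
    have := mul_lt_mul_of_pos_right hk2 (by positivity : (0 : ℝ) < n + 1)
    linarith

/-! ### Counting the missing speeds. -/

theorem card_filter_Ioc_add {X : Finset ℕ} {a b c : ℕ} (hab : a ≤ b) (hbc : b ≤ c) :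
    ((Finset.Ioc a c).filter (· ∈ X)).card
      = ((Finset.Ioc a b).filter (· ∈ X)).card + ((Finset.Ioc b c).filter (· ∈ X)).card := by
  rw [← Finset.Ioc_union_Ioc_eq_Ioc hab hbc, Finset.filter_union, Finset.card_union_of_disjoint]
  exact Finset.disjoint_filter_filter (Finset.Ioc_disjoint_Ioc_of_le le_rfl)

/-- Looseness from the existence of a sieve length `m` which is small compared to `2 n - v_n`. -/
theorem exists_time_of_isSieveLength {n w L k m : ℕ} (h : IsSieveLength L k m) (hn : 4 * n ≤ 2 ^ L)
    (v : Fin n → ℕ) (hv : ∀ i, 0 < v i) (hinj : Function.Injective v) (hvw : ∀ i, v i ≤ w)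
    (hw : ∃ i, v i = w) (hnw : n < w) (hwn : w + 10 * m + 20 ≤ 2 * n) :
    ∃ t : ℝ, ∀ i : Fin n, (1 : ℝ) / (n + 1) < Int.fract ((v i : ℝ) * t) ∧
        Int.fract ((v i : ℝ) * t) < (n : ℝ) / (n + 1) := by
  by_contra hno
  have hm : 0 < m :=
    lt_of_lt_of_le (Nat.mul_pos (by norm_num) (Nat.pow_pos (Nat.succ_pos L))) h.le_length
  set X : Finset ℕ := Finset.Icc 1 w \ Finset.univ.image v with hX
  have hmem : ∀ x, x ∈ X ↔ (1 ≤ x ∧ x ≤ w) ∧ ∀ i, v i ≠ x := by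
    intro x
    simp [hX]
  have hXcard : X.card = w - n := by
    rw [hX, Finset.card_sdiff_of_subset, Finset.card_image_of_injective _ hinj, Finset.card_univ,
      Fintype.card_fin, Nat.card_Icc, Nat.add_sub_cancel]
    intro x hx
    obtain ⟨i, -, rfl⟩ := Finset.mem_image.1 hx
    exact Finset.mem_Icc.2 ⟨hv i, hvw i⟩
  obtain ⟨B, hB⟩ : ∃ B, B = (w - n - 1) / (2 * m) := ⟨_, rfl⟩
  obtain ⟨W, hW⟩ : ∃ W, W = w / 2 := ⟨_, rfl⟩
  have hB1 : 2 * m * B ≤ w - n - 1 := by rw [hB]; exact Nat.mul_div_le _ _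
  have hB2 : w - n - 1 < 2 * m * B + 2 * m := by
    have := Nat.lt_mul_div_succ (w - n - 1) (show 0 < 2 * m by omega)
    rw [← hB] at this
    linarith
  -- For `x > W` a multiple of `x` beyond `x` itself exceeds `w`, so no speed is divisible by `x`.
  have hmid : ∀ x ∈ X, x ≤ n → x ≤ W := by
    intro x hx hxn
    by_contra hlt
    rw [hmem] at hx
    refine hno (exists_time_of_not_dvd v x (by omega) hxn fun i hdvd => ?_)
    obtain ⟨d, hd⟩ := hdvd
    have h1 := hvw i
    have h2 := hv i
    have h3 := hx.2 i
    rcases Nat.lt_or_ge d 2 with hd2 | hd2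
    · interval_cases d <;> omega
    · have : x * 2 ≤ x * d := Nat.mul_le_mul_left x hd2
      omega
  -- Here `w + x + 2 * m` is at most about `n + w / 2 + 4 * m`, which the margin `10 * m + 20` keeps
  -- below `2 * n + 1`.
  have hlow : ∀ x ∈ X, W < x + 2 * m * B := by
    intro x hx
    by_contra hlt
    rw [hmem] at hx
    obtain ⟨y, hy1, hy2, hxy⟩ := h.exists_coprime (x := x) (q := w - x) (by omega) (by omega)
    exact hno (exists_time_of_missing v hv x y (by omega) (by omega) hxy
      (fun i => by have := hvw i; omega) (by omega) (fun i => by have := hvw i; omega) hx.2)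
  have hpair : ∀ x ∈ X, ∀ y ∈ X, w < x + y → x + y ≤ 2 * n + 1 → ¬ Nat.Coprime x y := by
    intro x hx y hy h1 h2 hxy
    rw [hmem] at hx hy
    exact hno (exists_time_of_coprime_pair v hv x y hxy (fun i => (hvw i).trans_lt h1) h2
      (by omega) (by omega) hx.2 hy.2)
  have hblocks : ∀ b ≤ B, ((Finset.Ioc (W - 2 * m * b) W).filter (· ∈ X)).card
      + ((Finset.Ioc n (n + 2 * m * b)).filter (· ∈ X)).card ≤ 2 * m * b := by
    intro b
    induction b with
    | zero => simp
    | succ b ih =>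
      intro hb
      have ih' := ih (by omega)
      have hbB : 2 * m * (b + 1) ≤ 2 * m * B := Nat.mul_le_mul_left _ hb
      have e : 2 * m * (b + 1) = 2 * m * b + 2 * m := by ring
      rw [e] at hbB ⊢
      generalize 2 * m * b = u at *
      generalize 2 * m * B = z at *
      rw [card_filter_Ioc_add (show W - (u + 2 * m) ≤ W - u by omega) (Nat.sub_le _ _),
        card_filter_Ioc_add (show n ≤ n + u by omega) (show n + u ≤ n + (u + 2 * m) by omega)]
      have hnew := h.card_filter_Ioc_add_le (W - (u + 2 * m)) (n + u) (by omega) (by omega) X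
        (fun x hx y hy _ _ _ _ => hpair x hx y hy (by omega) (by omega))
      rw [show W - (u + 2 * m) + 2 * m = W - u by omega, add_assoc n u] at hnew
      omega
  have hfinal := hblocks B le_rfl
  generalize 2 * m * B = z at *
  -- The last interval stops at `w - 1` because `w` is a speed; this single element gives the
  -- contradiction.
  have hsub : X ⊆ ((Finset.Ioc (W - z) W).filter (· ∈ X) ∪ (Finset.Ioc n (n + z)).filter (· ∈ X))
      ∪ Finset.Ioc (n + z) (w - 1) := by
    intro x hx
    have h1 := hmid x hx
    have h2 := hlow x hx
    have h3 := (hmem x).1 hx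
    have h4 : x ≠ w := by
      rintro rfl
      obtain ⟨i, hi⟩ := hw
      exact h3.2 i hi
    simp only [Finset.mem_union, Finset.mem_filter, Finset.mem_Ioc, hx, and_true]
    omega
  have hcard := Finset.card_le_card hsub
  have hc1 := Finset.card_union_le ((Finset.Ioc (W - z) W).filter (· ∈ X) ∪
    (Finset.Ioc n (n + z)).filter (· ∈ X)) (Finset.Ioc (n + z) (w - 1))
  have hc2 := Finset.card_union_le ((Finset.Ioc (W - z) W).filter (· ∈ X))
    ((Finset.Ioc n (n + z)).filter (· ∈ X))
  rw [Nat.card_Ioc] at hc1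
  omega

/-! ### Choice of parameters and conclusion. -/

/-- For `log log n ≥ 2` there is a sieve length at most `exp (100 (log log n) ^ 2)` in size. -/
theorem exists_isSieveLength {n : ℕ} (hn : 0 < n) (hu : 2 ≤ Real.log (Real.log n)) :
    ∃ L k m : ℕ, IsSieveLength L k m ∧ 4 * n ≤ 2 ^ L ∧
      10 * (m : ℝ) + 20 ≤ Real.exp (100 * Real.log (Real.log n) ^ 2) := by
  set u := Real.log (Real.log n) with hudef
  have hn0 : (0 : ℝ) < n := by exact_mod_cast hn
  have hn1 : (1 : ℝ) ≤ n := by exact_mod_cast hn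
  have hl0 : 0 < Real.log n := by
    rcases (Real.log_nonneg hn1).eq_or_lt with h0 | h0
    · rw [hudef, ← h0, Real.log_zero] at hu
      linarith
    · exact h0
  have hl : Real.log n = Real.exp u := (Real.exp_log hl0).symm
  have he1 := Real.exp_one_gt_d9
  have he2 : (7 : ℝ) < Real.exp 2 := by
    have : Real.exp 2 = Real.exp 1 ^ 2 := by rw [← Real.exp_nat_mul]; norm_num
    rw [this]; nlinarith
  have heu : (7 : ℝ) < Real.exp u := he2.trans_le (Real.exp_le_exp.2 hu)
  have hsq : Real.exp (2 * u) = Real.exp u ^ 2 := by rw [← Real.exp_nat_mul]; norm_num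
  have hcube : Real.exp (3 * u) = Real.exp u ^ 3 := by rw [← Real.exp_nat_mul]; norm_num
  -- `L` is about `(log n) ^ 2` and `k` about `20 * log log n`, so `(L + 1) ^ (k + 1)` is
  -- `exp(O((log log n) ^ 2))`.
  obtain ⟨L, hL1, hL2⟩ : ∃ L : ℕ, Real.exp (2 * u) ≤ L ∧ (L : ℝ) + 1 ≤ Real.exp (3 * u) := by
    refine ⟨⌈Real.exp (2 * u)⌉₊, Nat.le_ceil _, ?_⟩
    have := Nat.ceil_lt_add_one (Real.exp_pos (2 * u)).le
    rw [hcube]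
    rw [hsq] at this ⊢
    nlinarith [sq_nonneg (Real.exp u)]
  obtain ⟨k, hk1, hk2⟩ : ∃ k : ℕ, 20 * u ≤ k ∧ (k : ℝ) + 1 ≤ 20 * u + 2 := by
    refine ⟨⌈20 * u⌉₊, Nat.le_ceil _, ?_⟩
    have := Nat.ceil_lt_add_one (show 0 ≤ 20 * u by linarith)
    linarith
  have hlog2 := Real.log_two_gt_d9
  have htwo : ∀ j : ℕ, (2 : ℝ) ^ j = Real.exp (j * Real.log 2) := fun j => by
    rw [Real.exp_nat_mul, Real.exp_log (by norm_num)]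
  have hL0 : (0 : ℝ) ≤ L := by positivity
  refine ⟨L, k, 1000000 * (L + 1) ^ (k + 1), ⟨?_, ?_, le_rfl⟩, ?_, ?_⟩
  · rw [hsq] at hL1
    have : (1 : ℝ) ≤ L := by nlinarith
    exact_mod_cast this
  · have h1 : (200 : ℝ) ≤ Real.exp (4 * u) := by
      have : Real.exp (4 * u) = Real.exp u ^ 4 := by rw [← Real.exp_nat_mul]; norm_num
      rw [this]
      have := pow_le_pow_left₀ (by norm_num) heu.le 4
      linarith
    have h2 : ((L : ℝ) + 1) ^ 3 ≤ Real.exp (9 * u) := by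
      have : Real.exp (9 * u) = Real.exp (3 * u) ^ 3 := by
        rw [← Real.exp_nat_mul]; congr 1; push_cast; ring
      rw [this]
      exact pow_le_pow_left₀ (by positivity) hL2 3
    have h3 : (200 : ℝ) * ((L : ℝ) + 1) ^ 3 ≤ 2 ^ k := by
      calc (200 : ℝ) * ((L : ℝ) + 1) ^ 3 ≤ Real.exp (4 * u) * Real.exp (9 * u) :=
            mul_le_mul h1 h2 (by positivity) (by positivity)
        _ = Real.exp (4 * u + 9 * u) := (Real.exp_add _ _).symm
        _ ≤ 2 ^ k := by
          rw [htwo, Real.exp_le_exp]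
          nlinarith
    exact_mod_cast h3
  · have h1 : 4 * (n : ℝ) ≤ 2 ^ L := by
      have h4 : (4 : ℝ) ≤ Real.exp 2 := by linarith
      calc 4 * (n : ℝ) ≤ Real.exp 2 * Real.exp (Real.exp u) := by
            rw [← hl, Real.exp_log hn0]
            exact mul_le_mul_of_nonneg_right h4 hn0.le
        _ = Real.exp (2 + Real.exp u) := (Real.exp_add _ _).symm
        _ ≤ 2 ^ L := by
          rw [htwo, Real.exp_le_exp]
          rw [hsq] at hL1
          nlinarith
    exact_mod_cast h1
  · push_cast
    have h1 : ((L : ℝ) + 1) ^ (k + 1) ≤ Real.exp (66 * u ^ 2) := by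
      calc ((L : ℝ) + 1) ^ (k + 1) ≤ Real.exp (3 * u) ^ (k + 1) :=
            pow_le_pow_left₀ (by positivity) hL2 _
        _ = Real.exp (((k : ℝ) + 1) * (3 * u)) := by
          rw [← Real.exp_nat_mul]; push_cast; ring_nf
        _ ≤ Real.exp (66 * u ^ 2) := by
          rw [Real.exp_le_exp]
          nlinarith
    have h2 : (20000000 : ℝ) ≤ Real.exp (34 * u ^ 2) := by
      have h3 : Real.exp 2 ^ 17 ≤ Real.exp (34 * u ^ 2) := by
        rw [← Real.exp_nat_mul, Real.exp_le_exp]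
        push_cast
        nlinarith
      have h4 := pow_le_pow_left₀ (by norm_num) he2.le 17
      refine le_trans ?_ (h4.trans h3)
      norm_num
    have h5 : (1 : ℝ) ≤ Real.exp (66 * u ^ 2) := Real.one_le_exp (by positivity)
    calc 10 * (1000000 * ((L : ℝ) + 1) ^ (k + 1)) + 20
        ≤ 20000000 * Real.exp (66 * u ^ 2) := by linarith
      _ ≤ Real.exp (34 * u ^ 2) * Real.exp (66 * u ^ 2) :=
          mul_le_mul_of_nonneg_right h2 (by positivity)
      _ = Real.exp (100 * u ^ 2) := by rw [← Real.exp_add]; ring_nf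

end LonelyRunner

theorem mainTheorem1 :
    ∃ C : ℝ, ∃ N : ℕ, ∀ n : ℕ, N ≤ n → ∀ hn : 0 < n,
      ∀ v : Fin n → ℕ, (∀ i, 0 < v i) → StrictMono v →
        n < v ⟨n - 1, Nat.sub_lt hn Nat.one_pos⟩ →
        (v ⟨n - 1, Nat.sub_lt hn Nat.one_pos⟩ : ℝ)
          ≤ 2 * (n : ℝ) - Real.exp (C * (Real.log (Real.log (n : ℝ))) ^ 2) →
        LonelyRunner.IsLoose v := by
  refine ⟨100, ⌈Real.exp (Real.exp 2)⌉₊, fun n hN hn v hv hmono hlow hup => ?_⟩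
  have hN' : Real.exp (Real.exp 2) ≤ n := Nat.ceil_le.1 hN
  have hn0 : (0 : ℝ) < n := by exact_mod_cast hn
  have h1 : Real.exp 2 ≤ Real.log n := (Real.le_log_iff_exp_le hn0).2 hN'
  have hu : 2 ≤ Real.log (Real.log n) :=
    (Real.le_log_iff_exp_le ((Real.exp_pos 2).trans_le h1)).2 h1
  obtain ⟨L, k, m, hs, hL, hm⟩ := LonelyRunner.exists_isSieveLength hn hu
  rw [LonelyRunner.isLoose_iff]
  refine LonelyRunner.exists_time_of_isSieveLength hs hL v hv hmono.injective
    (fun i => hmono.monotone ?_) ⟨_, rfl⟩ hlow ?_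
  · rw [Fin.le_def]
    have := i.2
    simp only
    omega
  · have : (v ⟨n - 1, Nat.sub_lt hn Nat.one_pos⟩ : ℝ) + 10 * m + 20 ≤ 2 * n := by linarith
    exact_mod_cast this
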